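/- Let $G=(V,E)$ be a finite directed graph. A stateless protocol on $G$ consists of a nonempty finite label space $\Sigma$ and, for each node $i\in V$, a reaction function $\delta_i:\Sigma^{-i}\times\{0,1\}\to\Sigma^{+i}\times\{0,1\}$, where $-i$ and $+i$ are the sets of edges entering and leaving $i$. Given an input $x\in\{0,1\}^V$ and an initial labeling $\ell^0\in\Sigma^E$, the protocol is run synchronously: at each time $t\ge 1$ every node $i$ sets the labels of its outgoing edges and its output bit by $(\ell^t_{+i},y_i^t)=\delta_i(\ell^{t-1}_{-i},x_i)$. The protocol computes $f:\{0,1\}^V\to\{0,1\}$ if, for every input $x$ and every initial labeling, the output sequence $y_i^1,y_i^2,\dots$ of every node $i$ converges to $f(x)$. Its label complexity is $\log_2|\Sigma|$. Let $\mathrm{OS}^u_{\log}$ be the class of languages $\mathcal L\subseteq\{0,1\}^*$ for which there is a family $A_1,A_2,\dots$ of stateless protocols such that, for every $n\ge 1$, $A_n$ runs on the unidirectional $n$-ring (nodes $1,\dots,n$, edges $1\to2\to\cdots\to n\to1$) and computes the indicator function of $\mathcal L$ on $\{0,1\}^n$, and such that $A_n$ has label complexity $O(\log n)$. Let $\mathrm{L/poly}$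 be the class of languages $\mathcal L\subseteq\{0,1\}^*$ for which there are a deterministic Turing machine $M$, with a read-only input tape, a separate read-only advice tape and a work tape, and advice strings $a(n)\in\{0,1\}^*$ of length polynomial in $n$, such that on every $x\in\{0,1\}^n$ with advice $a(n)$ the machine $M$ uses $O(\log n)$ cells of its work tape, halts, and accepts if and only if $x\in\mathcal L$. Theorem. $\mathrm{OS}^u_{\log}=\mathrm{L/poly}$. -/

import Mathlib

open Filter Asymptotics

/-! ## Stateless protocols -/

namespace Stateless

/-- The edges of a directed graph, as ordered pairs (tail, head). -/
abbrev Edge {V : Type} (G : Digraph V) : Type := {e : V × V // G.Adj e.1 e.2}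

/-- The edges entering the node `i`. -/
abbrev InEdge {V : Type} (G : Digraph V) (i : V) : Type := {e : Edge G // e.1.2 = i}

/-- The edges leaving the node `i`. -/
abbrev OutEdge {V : Type} (G : Digraph V) (i : V) : Type := {e : Edge G // e.1.1 = i}

/-- A stateless protocol on `G`: a nonempty finite label space and, for every node, a reaction
function that maps the labels of the incoming edges and the input bit of the node to the labels
of the outgoing edges and an output bit. -/
structure Protocol {V : Type} (G : Digraph V) where
  Label : Type
  [labelFintype : Fintype Label]
  [labelNonempty : Nonempty Label]
  react : (i : V) → (InEdge G i → Label) → Bool → (OutEdge G i → Label) × Bool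

attribute [instance] Protocol.labelFintype Protocol.labelNonempty

namespace Protocol

variable {V : Type} {G : Digraph V}

/-- The reaction of node `i` to the global labeling `l` and the global input `x`. -/
def reaction (A : Protocol G) (x : V → Bool) (l : Edge G → A.Label) (i : V) :
    (OutEdge G i → A.Label) × Bool :=
  A.react i (fun e => l e.1) (x i)

/-- One synchronous time step: every node is activated and relabels its outgoing edges. -/
def stepLabeling (A : Protocol G) (x : V → Bool) (l : Edge G → A.Label) : Edge G → A.Label :=
  fun e => (A.reaction x l e.1.1).1 ⟨e, rfl⟩

/-- The labeling after `t` synchronous time steps from the initial labeling `l`. -/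
def labeling (A : Protocol G) (x : V → Bool) (l : Edge G → A.Label) : ℕ → Edge G → A.Label
  | 0 => l
  | t + 1 => A.stepLabeling x (A.labeling x l t)

/-- The output of node `i` in time step `t + 1`. -/
def output (A : Protocol G) (x : V → Bool) (l : Edge G → A.Label) (t : ℕ) (i : V) : Bool :=
  (A.reaction x (A.labeling x l t) i).2

/-- The protocol computes `f`: for every input and every initial labeling, the output sequence
of every node converges to (that is, is eventually equal to) the value of `f`. -/
def Computes (A : Protocol G) (f : (V → Bool) → Bool) : Prop :=
  ∀ (x : V → Bool) (l : Edge G → A.Label) (i : V), ∀ᶠ t in atTop, A.output x l t i = f x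

/-- The label complexity: the length of a label in binary encoding. -/
noncomputable def labelComplexity (A : Protocol G) : ℝ :=
  Real.logb 2 (Fintype.card A.Label)

end Protocol

/-- The unidirectional `n`-ring, with the edges `i → i + 1` modulo `n`. -/
def uniRing (n : ℕ) : Digraph (Fin n) where
  Adj i j := (j : ℕ) = ((i : ℕ) + 1) % n

open Classical in
/-- The indicator function of the language `L` on the words of length `n`. -/
noncomputable def indicator (L : Language Bool) (n : ℕ) (x : Fin n → Bool) : Bool :=
  decide (List.ofFn x ∈ L)

/-- The class of the languages that are decided by a family `A₁, A₂, …` of stateless protocols,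
where `Aₙ` runs on the unidirectional `n`-ring and has label complexity `O(h(n))`. -/
def OSu (h : ℕ → ℝ) : Set (Language Bool) :=
  {L | ∃ A : (n : ℕ) → Protocol (uniRing n),
    (∀ n, 1 ≤ n → (A n).Computes (indicator L n)) ∧
    (fun n => (A n).labelComplexity) =O[atTop] h}

end Stateless

/-! ## Turing machines with advice and the class L/poly -/

namespace AdviceTM

/-- The content of a cell of a read-only tape, whose word stands between two end markers. -/
inductive Cell where
  | leftEnd
  | bit (b : Bool)
  | rightEnd

/-- A move of a tape head. -/
inductive Move where
  | left
  | stay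
  | right

/-- The cell `i` of the read-only tape with word `w`: the left end marker is in cell `0`, the
letters of `w` are in the cells `1, …, |w|`, and the right end marker is in cell `|w| + 1`. -/
def readCell (w : List Bool) : ℕ → Cell
  | 0 => Cell.leftEnd
  | i + 1 =>
    match w[i]? with
    | some b => Cell.bit b
    | none => Cell.rightEnd

/-- The move of the head of a read-only tape with word `w`; it cannot leave the end markers. -/
def moveReadOnly (w : List Bool) (i : ℕ) : Move → ℕ
  | Move.left => i - 1
  | Move.stay => i
  | Move.right => min (i + 1) (w.length + 1)

/-- The move of the head of the work tape, which is infinite to the right. A move to the left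
has no effect in the leftmost cell `0`. -/
def moveWork (i : ℕ) : Move → ℕ
  | Move.left => i - 1
  | Move.stay => i
  | Move.right => i + 1

/-- What a machine does in one step: the new state, the symbol written in the current cell of
the work tape, and the moves of the three heads. -/
structure Action (Q Γ : Type) where
  state : Q
  write : Γ
  inputMove : Move
  adviceMove : Move
  workMove : Move

/-- A deterministic Turing machine with a read-only input tape, a read-only advice tape and a
work tape, with finitely many states and a finite work alphabet. It halts when the transition
function returns `none`. -/
structure Machine where
  State : Type
  [stateFinite : Finite State]
  Symbol : Type
  [symbolFinite : Finite Symbol]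
  start : State
  accept : Set State
  blank : Symbol
  /-- current state, scanned input cell, scanned advice cell, scanned work tape symbol -/
  transition : State → Cell → Cell → Symbol → Option (Action State Symbol)

attribute [instance] Machine.stateFinite Machine.symbolFinite

namespace Machine

/-- A configuration of the machine, apart from the contents of the read-only tapes. -/
structure Config (M : Machine) where
  state : M.State
  inputHead : ℕ
  adviceHead : ℕ
  workHead : ℕ
  work : ℕ → M.Symbol

/-- The initial configuration: the work tape is blank, the heads of the read-only tapes are on
the left end markers, and the head of the work tape is on its leftmost cell. -/
def init (M : Machine) : M.Config where
  state := M.start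
  inputHead := 0
  adviceHead := 0
  workHead := 0
  work := fun _ => M.blank

/-- One step on the input `x` with the advice `a`; the value is `none` if the machine halts. -/
def step (M : Machine) (x a : List Bool) (c : M.Config) : Option M.Config :=
  (M.transition c.state (readCell x c.inputHead) (readCell a c.adviceHead)
      (c.work c.workHead)).map fun act =>
    { state := act.state
      inputHead := moveReadOnly x c.inputHead act.inputMove
      adviceHead := moveReadOnly a c.adviceHead act.adviceMove
      workHead := moveWork c.workHead act.workMove
      work := Function.update c.work c.workHead act.write }

/-- The configuration `c` occurs in the computation on the input `x` with the advice `a`. -/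
def Visits (M : Machine) (x a : List Bool) (c : M.Config) : Prop :=
  StateTransition.Reaches (M.step x a) M.init c

/-- The machine halts in an accepting state on the input `x` with the advice `a`. -/
def Accepts (M : Machine) (x a : List Bool) : Prop :=
  ∃ c, M.Visits x a c ∧ M.step x a c = none ∧ c.state ∈ M.accept

/-- The machine halts in a state that is not accepting. -/
def Rejects (M : Machine) (x a : List Bool) : Prop :=
  ∃ c, M.Visits x a c ∧ M.step x a c = none ∧ c.state ∉ M.accept

/-- The head of the work tape visits only the first `s` cells. -/
def UsesSpace (M : Machine) (x a : List Bool) (s : ℕ) : Prop :=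
  ∀ c, M.Visits x a c → c.workHead < s

end Machine

/-- The class L/poly: the languages that are decided by a deterministic logspace Turing machine
that receives, along with every input of length `n`, an advice string that depends only on `n`
and whose length is polynomially bounded in `n`. -/
def LPoly : Set (Language Bool) :=
  {L | ∃ (M : Machine) (advice : ℕ → List Bool) (s : ℕ → ℕ) (p : Polynomial ℕ),
    (∀ n, (advice n).length ≤ p.eval n) ∧
    (fun n => (s n : ℝ)) =O[atTop] (fun n : ℕ => Real.logb 2 n) ∧
    ∀ x : List Bool,
      (x ∈ L → M.Accepts x (advice x.length)) ∧
      (x ∉ L → M.Rejects x (advice x.length)) ∧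
      M.UsesSpace x (advice x.length) (s x.length)}

end AdviceTM

/-!
On the unidirectional ring, the label that is on one edge at time `t` determines, together with one
input bit, the label on the next edge at time `t + 1`. So the initial labels travel around the ring
without interacting, and a protocol is a family of independent computations on the finite set of
pairs (label, node), each step of which reads one input bit (`Protocol.computes_iff_token`). Both
inclusions compare such computations with Turing machines.

From a protocol to a machine (`OSu_subset_lPoly`): after as many steps as there are pairs (label,
node), a travelling label has entered a cycle, on which the output is correct already
(`iterate_card_of_eventually`). Hence it suffices to follow one label for polynomially many steps.
The advice is a straight-line program that does this. For every step it lists the lookup table of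
one reaction function; a record of the table compares its key with the label on the work tape, and
in case of a match replaces the label. A fixed machine, `interpreter`, executes such programs in one
pass over the advice, and its work tape holds nothing but the binary code of the current label.

From a machine to a protocol (`lPoly_subset_OSu`): a machine in logarithmic space has polynomially
many configurations on the words of length `n`. A label holds a configuration, a step counter, and a
verdict. It travels to the node whose input bit the machine scans, and there makes one step. As the
initial label is arbitrary, the computation is restarted whenever the counter reaches the number of
configurations, by which time the machine has halted (`Machine.iterate_card_of_halts`), and the
verdict is updated at every restart. From the second restart on it is correct
(`restart_eventually`), and it is what the nodes output.
-/

/-! ### Iteration on finite types -/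

/-- If `P` holds eventually along an orbit, then it holds at time `Fintype.card α` already: by then
the orbit has entered its cycle. -/
theorem iterate_card_of_eventually {α : Type*} [Fintype α] (F : α → α) (a : α) (P : α → Prop)
    (h : ∀ᶠ t in atTop, P (F^[t] a)) : P (F^[Fintype.card α] a) := by
  obtain ⟨i, j, hij, heq⟩ :=
    Fintype.exists_ne_map_eq_of_card_lt (fun k : Fin (Fintype.card α + 1) => F^[(k : ℕ)] a)
      (by simp)
  wlog hlt : i < j generalizing i j
  · exact this j i hij.symm heq.symm (lt_of_le_of_ne (not_lt.mp hlt) hij.symm)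
  have hi : (i : ℕ) ≤ Fintype.card α := Nat.lt_succ_iff.mp i.2
  have hper : Function.IsPeriodicPt F (j - i) (F^[(i : ℕ)] a) := by
    rw [Function.IsPeriodicPt, Function.IsFixedPt, ← Function.iterate_add_apply,
      Nat.sub_add_cancel (le_of_lt hlt)]
    exact heq.symm
  have hper' : Function.IsPeriodicPt F (j - i) (F^[Fintype.card α] a) := by
    have := hper.apply_iterate (Fintype.card α - i)
    rwa [← Function.iterate_add_apply, Nat.sub_add_cancel hi] at this
  obtain ⟨t₀, ht₀⟩ := eventually_atTop.mp h
  have hpos : 0 < (j : ℕ) - i := Nat.sub_pos_of_lt hlt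
  have := ht₀ ((j - i) * t₀ + Fintype.card α)
    ((Nat.le_mul_of_pos_left t₀ hpos).trans (Nat.le_add_right _ _))
  rwa [Function.iterate_add_apply, (hper'.mul_const t₀).eq] at this

/-! ### Polynomial growth -/

/-- The sequence `u` is bounded by a power of `n`, for all large `n`. -/
def PolyBounded (u : ℕ → ℕ) : Prop :=
  ∃ d, ∀ᶠ n in atTop, u n ≤ n ^ d

namespace PolyBounded

variable {u v : ℕ → ℕ}

theorem mono (hv : PolyBounded v) (h : ∀ᶠ n in atTop, u n ≤ v n) : PolyBounded u := by
  obtain ⟨d, hd⟩ := hv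
  exact ⟨d, by filter_upwards [hd, h] with n h₁ h₂ using h₂.trans h₁⟩

theorem const (k : ℕ) : PolyBounded fun _ => k :=
  ⟨1, by filter_upwards [eventually_ge_atTop k] with n hn using by simpa using hn⟩

theorem id : PolyBounded fun n => n :=
  ⟨1, by simp⟩

theorem mul (hu : PolyBounded u) (hv : PolyBounded v) : PolyBounded fun n => u n * v n := by
  obtain ⟨d, hd⟩ := hu
  obtain ⟨e, he⟩ := hv
  refine ⟨d + e, ?_⟩
  filter_upwards [hd, he] with n h₁ h₂
  rw [pow_add]
  exact Nat.mul_le_mul h₁ h₂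

theorem add (hu : PolyBounded u) (hv : PolyBounded v) : PolyBounded fun n => u n + v n := by
  have h : PolyBounded fun n => 2 * ((u n + 1) * (v n + 1)) := by
    have succ : ∀ {w : ℕ → ℕ}, PolyBounded w → PolyBounded fun n => w n + 1 := by
      rintro w ⟨d, hd⟩
      refine ⟨d + 1, ?_⟩
      filter_upwards [hd, eventually_ge_atTop 2] with n h₁ h₂
      have : 1 ≤ n ^ d := Nat.one_le_pow _ _ (by omega)
      rw [pow_succ]
      nlinarith
    exact (const 2).mul ((succ hu).mul (succ hv))
  exact h.mono (Eventually.of_forall fun n => by nlinarith [Nat.zero_le (u n * v n)])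

theorem eval (p : Polynomial ℕ) : PolyBounded fun n => p.eval n := by
  induction p using Polynomial.induction_on' with
  | add p q hp hq => simpa using hp.add hq
  | monomial k c =>
    have h : PolyBounded fun n => n ^ k := ⟨k, by simp⟩
    simpa using (const c).mul h

theorem exists_polynomial (hu : PolyBounded u) : ∃ p : Polynomial ℕ, ∀ n, u n ≤ p.eval n := by
  obtain ⟨d, hd⟩ := hu
  obtain ⟨m, hm⟩ := eventually_atTop.mp hd
  refine ⟨Polynomial.X ^ d + Polynomial.C (∑ k ∈ Finset.range m, u k), fun n => ?_⟩
  rw [Polynomial.eval_add, Polynomial.eval_pow, Polynomial.eval_X, Polynomial.eval_C]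
  rcases le_or_gt m n with h | h
  · exact (hm n h).trans (Nat.le_add_right _ _)
  · exact (Finset.single_le_sum (fun k _ => Nat.zero_le (u k)) (Finset.mem_range.mpr h)).trans
      (Nat.le_add_left _ _)

theorem of_isBigO_logb
    (h : (fun n => Real.logb 2 (u n)) =O[atTop] fun n : ℕ => Real.logb 2 n) : PolyBounded u := by
  obtain ⟨c, hc⟩ := h.bound
  obtain ⟨d, hd⟩ := exists_nat_ge c
  refine ⟨d, ?_⟩
  filter_upwards [hc, eventually_ge_atTop 1] with n hn h1
  rcases Nat.eq_zero_or_pos (u n) with h0 | h0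
  · simp [h0]
  have hlog : 0 ≤ Real.logb 2 n := Real.logb_nonneg one_lt_two (by exact_mod_cast h1)
  rw [Real.norm_of_nonneg hlog] at hn
  have : Real.logb 2 (u n) ≤ Real.logb 2 ((n : ℝ) ^ d) := by
    rw [Real.logb_pow]
    exact (Real.le_norm_self _).trans (hn.trans (mul_le_mul_of_nonneg_right hd hlog))
  have := (Real.logb_le_logb one_lt_two (by exact_mod_cast h0)
    (pow_pos (by exact_mod_cast h1) d)).mp this
  exact_mod_cast this

theorem isBigO_logb (hu : PolyBounded u) (h1 : ∀ n, 1 ≤ u n) :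
    (fun n => Real.logb 2 (u n)) =O[atTop] fun n : ℕ => Real.logb 2 n := by
  obtain ⟨d, hd⟩ := hu
  refine IsBigO.of_bound d ?_
  filter_upwards [hd, eventually_ge_atTop 1] with n hn h2
  have hlog : 0 ≤ Real.logb 2 n := Real.logb_nonneg one_lt_two (by exact_mod_cast h2)
  have hpos : (0 : ℝ) < u n := by exact_mod_cast h1 n
  rw [Real.norm_of_nonneg hlog, Real.norm_of_nonneg
    (Real.logb_nonneg one_lt_two (by exact_mod_cast h1 n)), ← Real.logb_pow]
  exact Real.logb_le_logb_of_le one_lt_two hpos (by exact_mod_cast hn)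

theorem const_pow (k : ℕ) (h : (fun n => (u n : ℝ)) =O[atTop] fun n : ℕ => Real.logb 2 n) :
    PolyBounded fun n => k ^ u n := by
  refine of_isBigO_logb ?_
  simp only [Nat.cast_pow, Real.logb_pow]
  simpa only [mul_comm] using h.const_mul_left (Real.logb 2 k)

end PolyBounded

theorem one_isBigO_logb : (fun _ => (1 : ℝ)) =O[atTop] fun n : ℕ => Real.logb 2 n := by
  have := (PolyBounded.const 2).isBigO_logb (fun _ => by norm_num)
  simpa using this

/-! ### Labels that travel around the ring -/

namespace Stateless

variable {n : ℕ} [NeZero n]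

theorem uniRing_adj_iff (i j : Fin n) : (uniRing n).Adj i j ↔ j = i + 1 := by
  have h : ((i + 1 : Fin n) : ℕ) = ((i : ℕ) + 1) % n := by
    rw [Fin.val_add, Fin.val_one', Nat.add_mod_mod]
  rw [Fin.ext_iff, h]
  rfl

/-- The edge of the unidirectional ring that leaves the node `i`. -/
def edgeFrom (i : Fin n) : Edge (uniRing n) :=
  ⟨(i, i + 1), (uniRing_adj_iff i (i + 1)).mpr rfl⟩

theorem inEdge_eq (i : Fin n) (e : InEdge (uniRing n) (i + 1)) : e.1 = edgeFrom i := by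
  obtain ⟨⟨⟨j, k⟩, hjk⟩, hk⟩ := e
  have h : k = j + 1 := (uniRing_adj_iff j k).mp hjk
  have h' : k = i + 1 := hk
  have hj : j = i := add_right_cancel (h.symm.trans h')
  subst h' hj
  rfl

namespace Protocol

variable (A : Protocol (uniRing n)) (x : Fin n → Bool)

/-- The label that node `i` sends when it receives the label `v` and its input bit is `b`. -/
def pass (i : Fin n) (v : A.Label) (b : Bool) : A.Label :=
  (A.react i (fun _ => v) b).1 ⟨edgeFrom i, rfl⟩

/-- The output of node `i` when it receives the label `v` and its input bit is `b`. -/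
def emit (i : Fin n) (v : A.Label) (b : Bool) : Bool :=
  (A.react i (fun _ => v) b).2

/-- One time step, followed along the ring: a label `v` on the edge that leaves `i` determines
the label on the edge that leaves `i + 1` one time step later. -/
def token (p : A.Label × Fin n) : A.Label × Fin n :=
  (A.pass (p.2 + 1) p.1 (x (p.2 + 1)), p.2 + 1)

theorem reaction_succ (l : Edge (uniRing n) → A.Label) (i : Fin n) :
    A.reaction x l (i + 1) = A.react (i + 1) (fun _ => l (edgeFrom i)) (x (i + 1)) := by
  unfold reaction
  congr 1
  funext e
  rw [inEdge_eq i e]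

theorem labeling_token (l : Edge (uniRing n) → A.Label) (i : Fin n) (t : ℕ) :
    A.labeling x l t (edgeFrom ((A.token x)^[t] (l (edgeFrom i), i)).2) =
      ((A.token x)^[t] (l (edgeFrom i), i)).1 := by
  induction t with
  | zero => rfl
  | succ t ih =>
    rw [Function.iterate_succ_apply']
    generalize (A.token x)^[t] (l (edgeFrom i), i) = p at ih ⊢
    change (A.reaction x (A.labeling x l t) (p.2 + 1)).1 ⟨edgeFrom (p.2 + 1), rfl⟩ =
      A.pass (p.2 + 1) p.1 (x (p.2 + 1))
    rw [reaction_succ, ih]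
    rfl

theorem token_iterate_snd (p : A.Label × Fin n) (t : ℕ) :
    ((A.token x)^[t] p).2 = p.2 + Fin.ofNat n t := by
  induction t with
  | zero => simp
  | succ t ih =>
    rw [Function.iterate_succ_apply']
    change ((A.token x)^[t] p).2 + 1 = _
    rw [ih, add_assoc]
    congr 1
    ext
    simp [Fin.val_add]

theorem output_token (l : Edge (uniRing n) → A.Label) (i : Fin n) (t : ℕ) :
    A.output x l t (((A.token x)^[t] (l (edgeFrom i), i)).2 + 1) =
      A.emit (((A.token x)^[t] (l (edgeFrom i), i)).2 + 1) ((A.token x)^[t] (l (edgeFrom i), i)).1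
        (x (((A.token x)^[t] (l (edgeFrom i), i)).2 + 1)) := by
  rw [output, reaction_succ, labeling_token]
  rfl

/-- A protocol on the unidirectional ring computes `f` if and only if the outputs seen by every
travelling label converge to the value of `f`: the labels that start on different edges never
interact. -/
theorem computes_iff_token (f : (Fin n → Bool) → Bool) :
    A.Computes f ↔ ∀ (x : Fin n → Bool) (p : A.Label × Fin n), ∀ᶠ t in atTop,
      A.emit (((A.token x)^[t] p).2 + 1) ((A.token x)^[t] p).1
        (x (((A.token x)^[t] p).2 + 1)) = f x := by
  constructor
  · rintro h x ⟨v, i⟩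
    have hall := eventually_all.mpr (h x fun _ => v)
    filter_upwards [hall] with t ht
    rw [← A.output_token x (fun _ => v) i t]
    exact ht _
  · intro h x l i
    have hall := eventually_all.mpr fun j => h x (l (edgeFrom j), j)
    filter_upwards [hall] with t ht
    have key := ht (i - 1 - Fin.ofNat n t)
    rw [← output_token, token_iterate_snd] at key
    simpa using key

end Protocol

/-! ### Protocols from computations that query input bits -/

section Query

variable {n : ℕ} [NeZero n] {Z : Type}

/-- The protocol in which a label is a state of a computation that reads one input bit in every
step. A label `z` travels unchanged up to the node `pos z`, whose input bit it reads, and is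
replaced there with its successor state. Every node outputs the result that is stored in the label
it receives. -/
def queryProtocol [Fintype Z] [Nonempty Z] (pos : Z → Fin n) (adv : Z → Bool → Z)
    (res : Z → Bool) : Protocol (uniRing n) where
  Label := Z
  react i ins b :=
    let z := ins ⟨edgeFrom (i - 1), by simp [edgeFrom]⟩
    (fun _ => if pos z = i then adv z b else z, res z)

theorem queryProtocol_computes [Fintype Z] [Nonempty Z] (pos : Z → Fin n) (adv : Z → Bool → Z)
    (res : Z → Bool) (f : (Fin n → Bool) → Bool)
    (h : ∀ x z, ∀ᶠ t in atTop, res ((fun z => adv z (x (pos z)))^[t] z) = f x) :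
    (queryProtocol pos adv res).Computes f := by
  rw [Protocol.computes_iff_token]
  intro x p
  obtain ⟨z, i⟩ : Z × Fin n := p
  set F : Z → Z := fun z => adv z (x (pos z)) with hF
  set q : ℕ → Z × Fin n := fun t => ((queryProtocol pos adv res).token x)^[t] (z, i) with hq
  have hsnd : ∀ t, (q t).2 = i + Fin.ofNat n t :=
    fun t => Protocol.token_iterate_snd (queryProtocol pos adv res) x (z, i) t
  have hstep : ∀ t, (q (t + 1)).1 =
      if pos (q t).1 = (q t).2 + 1 then F (q t).1 else (q t).1 := by
    intro t
    have : q (t + 1) = (queryProtocol pos adv res).token x (q t) :=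
      Function.iterate_succ_apply' _ _ _
    rw [this]
    change (if pos (q t).1 = (q t).2 + 1 then adv (q t).1 (x ((q t).2 + 1)) else (q t).1) = _
    split_ifs with hp
    · rw [hF, ← hp]
    · rfl
  -- `j t` is the number of steps of the computation that the label has made up to time `t`
  let j : ℕ → ℕ := fun t =>
    Nat.rec 0 (fun t k => if pos (q t).1 = (q t).2 + 1 then k + 1 else k) t
  have hj : ∀ t, j (t + 1) = if pos (q t).1 = (q t).2 + 1 then j t + 1 else j t := fun t => rfl
  have hqj : ∀ t, (q t).1 = F^[j t] z := by
    intro t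
    induction t with
    | zero => rfl
    | succ t ih =>
      rw [hstep, hj]
      split_ifs
      · rw [Function.iterate_succ_apply', ih]
      · exact ih
  have hmono : Monotone j := monotone_nat_of_le_succ fun t => by
    rw [hj]
    split_ifs <;> omega
  have hincr : ∀ t, ∃ t', j t + 1 ≤ j t' := by
    intro t
    by_contra hcon
    simp only [not_exists, not_le] at hcon
    have hconst : ∀ r, j (t + r) = j t := fun r =>
      le_antisymm (Nat.lt_succ_iff.mp (hcon _)) (hmono (Nat.le_add_right _ _))
    -- within one round the label meets the node whose input it waits for
    obtain ⟨r, hr⟩ : ∃ r : ℕ, Fin.ofNat n r = pos (q t).1 - 1 - (q t).2 :=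
      ⟨(pos (q t).1 - 1 - (q t).2 : Fin n), by simp⟩
    have hpos : pos (q (t + r)).1 = (q (t + r)).2 + 1 := by
      have hsame : (q (t + r)).1 = (q t).1 := by rw [hqj, hqj, hconst]
      have hadd : Fin.ofNat n (t + r) = Fin.ofNat n t + Fin.ofNat n r := by
        ext
        simp [Fin.val_add]
      rw [hsame, hsnd, hadd, ← add_assoc, ← hsnd t, hr]
      abel
    have := hj (t + r)
    rw [if_pos hpos, hconst] at this
    have := hconst (r + 1)
    rw [← add_assoc] at this
    omega
  have htend : Tendsto j atTop atTop := tendsto_atTop_atTop_of_monotone hmono fun b => by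
    induction b with
    | zero => exact ⟨0, Nat.zero_le _⟩
    | succ b ih =>
      obtain ⟨t, ht⟩ := ih
      obtain ⟨t', ht'⟩ := hincr t
      exact ⟨t', by omega⟩
  filter_upwards [htend.eventually (h x z)] with t ht
  change res (q t).1 = f x
  rw [hqj]
  exact ht

end Query

variable {C : Type}

/-- One step of the computation that iterates `step` from `start`, restarts after `T` steps, and
keeps the verdict on the last finished round in its last component. -/
def restart (step : C → Bool → C) (start : C) (acc : C → Bool) (T : ℕ)
    (z : C × Fin (T + 1) × Bool) (b : Bool) : C × Fin (T + 1) × Bool :=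
  if z.2.1 = Fin.last T then (start, 0, acc z.1) else (step z.1 b, z.2.1 + 1, z.2.2)

/-- A computation with periodic restarts stabilizes from every initial state: after the first
restart its state is legitimate, and after the second one its verdict is correct for ever. -/
theorem restart_eventually (step : C → Bool → C) (bit : C → Bool) (start : C)
    (acc : C → Bool) (y : Bool) (T : ℕ) (h : acc ((fun c => step c (bit c))^[T] start) = y)
    (z : C × Fin (T + 1) × Bool) :
    ∀ᶠ t in atTop, ((fun z => restart step start acc T z (bit z.1))^[t] z).2.2 = y := by
  set G := fun z => restart step start acc T z (bit z.1) with hG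
  set S : C → C := fun c => step c (bit c) with hS
  have hlast : ∀ z : C × Fin (T + 1) × Bool, z.2.1 = Fin.last T → G z = (start, 0, acc z.1) :=
    fun z hz => if_pos hz
  have hnot : ∀ z : C × Fin (T + 1) × Bool, z.2.1 ≠ Fin.last T →
      G z = (S z.1, z.2.1 + 1, z.2.2) := fun z hz => if_neg hz
  have hval : ∀ k : Fin (T + 1), k ≠ Fin.last T → ((k + 1 : Fin (T + 1)) : ℕ) = k + 1 :=
    fun k hk => Fin.val_add_one_of_lt (Fin.lt_last_iff_ne_last.mpr hk)
  have reach : ∀ r (z : C × Fin (T + 1) × Bool), T - z.2.1 = r →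
      ∃ t, (G^[t] z).2.1 = Fin.last T := by
    intro r
    induction r with
    | zero =>
      intro z hz
      exact ⟨0, Fin.ext (by simp; omega)⟩
    | succ r ih =>
      intro z hz
      have hne : z.2.1 ≠ Fin.last T := fun e => by rw [e, Fin.val_last] at hz; omega
      obtain ⟨t, ht⟩ := ih (G z) (by rw [hnot z hne]; simp only [hval _ hne]; omega)
      exact ⟨t + 1, by rwa [Function.iterate_succ_apply]⟩
  have legit : ∀ z : C × Fin (T + 1) × Bool, z.1 = S^[(z.2.1 : ℕ)] start →
      (G z).1 = S^[((G z).2.1 : ℕ)] start := by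
    intro z hz
    by_cases hl : z.2.1 = Fin.last T
    · rw [hlast z hl]; rfl
    · rw [hnot z hl]
      simp only [hval _ hl, Function.iterate_succ_apply', hz]
  have legit_iter : ∀ t (z : C × Fin (T + 1) × Bool), z.1 = S^[(z.2.1 : ℕ)] start →
      (G^[t] z).1 = S^[((G^[t] z).2.1 : ℕ)] start := by
    intro t z hz
    induction t with
    | zero => exact hz
    | succ t ih => rw [Function.iterate_succ_apply']; exact legit _ ih
  have verdict : ∀ z : C × Fin (T + 1) × Bool, z.1 = S^[(z.2.1 : ℕ)] start →
      z.2.1 = Fin.last T → (G z).2.2 = y := by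
    intro z hz hl
    rw [hlast z hl, ← h]
    change acc z.1 = _
    rw [hz, hl, Fin.val_last]
  obtain ⟨t₁, h₁⟩ := reach _ z rfl
  have hz₁ : (G^[t₁ + 1] z).1 = S^[((G^[t₁ + 1] z).2.1 : ℕ)] start := by
    rw [Function.iterate_succ_apply', hlast _ h₁]; rfl
  obtain ⟨t₂, h₂⟩ := reach _ (G^[t₁ + 1] z) rfl
  have hz₂ := legit_iter t₂ _ hz₁
  set w := G^[t₂] (G^[t₁ + 1] z) with hw
  have final : ∀ t, (G^[t] (G w)).2.2 = y := by
    intro t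
    induction t with
    | zero => exact verdict w hz₂ h₂
    | succ t ih =>
      have hl := legit_iter t _ (legit w hz₂)
      rw [Function.iterate_succ_apply']
      by_cases he : (G^[t] (G w)).2.1 = Fin.last T
      · exact verdict _ hl he
      · rw [hnot _ he]; exact ih
  filter_upwards [eventually_ge_atTop (1 + (t₂ + (t₁ + 1)))] with t ht
  obtain ⟨r, rfl⟩ := Nat.exists_eq_add_of_le' ht
  rw [Function.iterate_add_apply, Function.iterate_add_apply G 1,
    Function.iterate_add_apply G t₂]
  exact final r

end Stateless

/-! ### Configurations of a machine in bounded space -/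

namespace AdviceTM

namespace Machine

variable (M : Machine)

/-- The configurations in which the heads stand on the `n` input letters, the `m` advice letters
(or their end markers) and the first `s` cells of the work tape, which is blank beyond these
cells. -/
structure Bounded (n m s : ℕ) (c : M.Config) : Prop where
  inputHead_le : c.inputHead ≤ n + 1
  adviceHead_le : c.adviceHead ≤ m + 1
  workHead_lt : c.workHead < s
  work_eq : ∀ j, s ≤ j → c.work j = M.blank

variable {M} {n m s : ℕ}

/-- A bounded configuration as an element of a finite product: the state, the positions of the
three heads, and the first `s` cells of the work tape. -/
def boundedCode (c : {c : M.Config // M.Bounded n m s c}) :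
    M.State × Fin (n + 2) × Fin (m + 2) × Fin s × (Fin s → M.Symbol) :=
  (c.1.state, ⟨c.1.inputHead, Nat.lt_succ_of_le c.2.inputHead_le⟩,
    ⟨c.1.adviceHead, Nat.lt_succ_of_le c.2.adviceHead_le⟩, ⟨c.1.workHead, c.2.workHead_lt⟩,
    fun j => c.1.work j)

theorem boundedCode_injective :
    Function.Injective (boundedCode (M := M) (n := n) (m := m) (s := s)) := by
  rintro ⟨⟨q, i, a, w, τ⟩, hc⟩ ⟨⟨q', i', a', w', τ'⟩, hc'⟩ h
  simp only [boundedCode, Prod.mk.injEq, Fin.mk.injEq] at h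
  obtain ⟨rfl, rfl, rfl, rfl, hτ⟩ := h
  have : τ = τ' := by
    funext j
    rcases lt_or_ge j s with hj | hj
    · exact congrFun hτ ⟨j, hj⟩
    · exact (hc.work_eq j hj).trans (hc'.work_eq j hj).symm
  subst this
  rfl

instance : Finite {c : M.Config // M.Bounded n m s c} :=
  Finite.of_injective _ boundedCode_injective

theorem card_bounded_le : Nat.card {c : M.Config // M.Bounded n m s c} ≤
    Nat.card M.State * ((n + 2) * ((m + 2) * (s * Nat.card M.Symbol ^ s))) := by
  refine (Nat.card_le_card_of_injective _ boundedCode_injective).trans_eq ?_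
  simp [Nat.card_prod, Nat.card_fun]

theorem bounded_init (hs : 0 < s) : M.Bounded n m s M.init :=
  ⟨Nat.zero_le _, Nat.zero_le _, hs, fun _ _ => rfl⟩

theorem moveReadOnly_le (w : List Bool) (i : ℕ) (d : Move) (h : i ≤ w.length + 1) :
    moveReadOnly w i d ≤ w.length + 1 := by
  cases d
  · exact (Nat.sub_le _ _).trans h
  · exact h
  · exact Nat.min_le_right _ _

theorem Bounded.step {x a : List Bool} {c c' : M.Config}
    (hc : M.Bounded x.length a.length s c) (h : M.step x a c = some c') (hw : c'.workHead < s) :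
    M.Bounded x.length a.length s c' := by
  unfold Machine.step at h
  obtain ⟨act, -, rfl⟩ := Option.map_eq_some_iff.mp h
  refine ⟨moveReadOnly_le _ _ _ hc.inputHead_le, moveReadOnly_le _ _ _ hc.adviceHead_le, hw,
    fun j hj => ?_⟩
  have : j ≠ c.workHead := fun e => absurd hc.workHead_lt (by omega)
  exact (Function.update_of_ne this _ _).trans (hc.work_eq j hj)

/-- The position of the input bit that the machine scans; it is arbitrary on the end markers. -/
def inputPos (n : ℕ) [NeZero n] (c : M.Config) : Fin n :=
  Fin.ofNat n (c.inputHead - 1)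

/-- A step depends on the input only through its length and the scanned bit, so that the input may
be replaced with a constant word. -/
theorem step_replicate [NeZero n] (x : Fin n → Bool) (a : List Bool) (c : M.Config)
    (hc : c.inputHead ≤ n + 1) :
    M.step (List.replicate n (x (inputPos n c))) a c = M.step (List.ofFn x) a c := by
  have hread : readCell (List.replicate n (x (inputPos n c))) c.inputHead =
      readCell (List.ofFn x) c.inputHead := by
    obtain ⟨q, i, k, w, τ⟩ := c
    rcases i with _ | i
    · rfl
    simp only [readCell]
    rcases lt_or_ge i n with hi | hi
    · have : inputPos (M := M) n ⟨q, i + 1, k, w, τ⟩ = ⟨i, hi⟩ := by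
        ext
        simp [inputPos, Nat.mod_eq_of_lt hi]
      simp [this, hi]
    · simp [hi,]
  have hmove : ∀ d, moveReadOnly (List.replicate n (x (inputPos n c))) c.inputHead d =
      moveReadOnly (List.ofFn x) c.inputHead d := by
    intro d
    cases d <;> simp [moveReadOnly]
  unfold Machine.step
  simp only [hread, hmove]

open Classical in
/-- One step on the bounded configurations, for an input bit `b` under the input head. It stays
put where the machine halts or leaves the bounds. -/
noncomputable def boundedStep (a : List Bool) (c : {c : M.Config // M.Bounded n a.length s c})
    (b : Bool) : {c : M.Config // M.Bounded n a.length s c} :=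
  match M.step (List.replicate n b) a c.1 with
  | none => c
  | some c' => if h : M.Bounded n a.length s c' then ⟨c', h⟩ else c

/-- One step on the bounded configurations, on the input `x`. -/
noncomputable def inputStep [NeZero n] (x : Fin n → Bool) (a : List Bool)
    (c : {c : M.Config // M.Bounded n a.length s c}) :
    {c : M.Config // M.Bounded n a.length s c} :=
  boundedStep a c (x (inputPos n c.1))

/-- The truncation in `boundedStep` never takes effect in a computation within the space bound. -/
theorem exists_iterate_of_visits [NeZero n] (x : Fin n → Bool) (a : List Bool) (hs : 0 < s)
    (hspace : M.UsesSpace (List.ofFn x) a s) (c : M.Config) (hc : M.Visits (List.ofFn x) a c) :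
    ∃ t, ((inputStep x a)^[t] ⟨M.init, bounded_init (n := n) hs⟩).1 = c := by
  induction hc with
  | refl => exact ⟨0, rfl⟩
  | @tail c c' hcc hstep ih =>
    obtain ⟨t, rfl⟩ := ih
    refine ⟨t + 1, ?_⟩
    rw [Function.iterate_succ_apply']
    generalize (inputStep x a)^[t] ⟨M.init, bounded_init (n := n) hs⟩ = d at hcc hstep
    have hstep : M.step (List.ofFn x) a d.1 = some c' := hstep
    have hb : M.Bounded n a.length s c' := by
      have hd : M.Bounded (List.ofFn x).length a.length s d.1 := by simpa using d.2
      simpa using hd.step hstep (hspace c' (hcc.tail hstep))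
    simp [inputStep, boundedStep, step_replicate x a d.1 d.2.inputHead_le, hstep, hb]

/-- A halting configuration is a fixed point of `inputStep`, so that it is reached within as many
steps as there are bounded configurations. -/
theorem iterate_card_of_halts [NeZero n] (x : Fin n → Bool) (a : List Bool) (hs : 0 < s)
    (hspace : M.UsesSpace (List.ofFn x) a s) (c : M.Config) (hc : M.Visits (List.ofFn x) a c)
    (hhalt : M.step (List.ofFn x) a c = none) :
    ((inputStep x a)^[Nat.card {c : M.Config // M.Bounded n a.length s c}]
      ⟨M.init, bounded_init (n := n) hs⟩).1 = c := by
  have := Fintype.ofFinite {c : M.Config // M.Bounded n a.length s c}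
  rw [Nat.card_eq_fintype_card]
  refine iterate_card_of_eventually _ _
    (fun d : {c : M.Config // M.Bounded n a.length s c} => d.1 = c) ?_
  obtain ⟨t, ht⟩ := exists_iterate_of_visits x a hs hspace c hc
  filter_upwards [eventually_ge_atTop t] with t' ht'
  obtain ⟨r, rfl⟩ := Nat.exists_eq_add_of_le' ht'
  rw [Function.iterate_add_apply]
  generalize (inputStep x a)^[t] ⟨M.init, bounded_init (n := n) hs⟩ = d at ht
  subst ht
  have hfix : Function.IsFixedPt (inputStep x a) d := by
    simp [Function.IsFixedPt, inputStep, boundedStep,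
      step_replicate x a d.1 d.2.inputHead_le, hhalt]
  rw [hfix.iterate r]

end Machine

/-! ### From a machine to protocols -/

open Stateless

open Classical in
/-- A machine that uses space `s` on the words of length `n` yields a protocol on the `n`-ring
whose labels are pairs of a configuration and a step counter, and a verdict. -/
theorem exists_protocol (M : Machine) {n : ℕ} [NeZero n] (a : List Bool) (s : ℕ)
    (L : Language Bool)
    (h : ∀ x : Fin n → Bool, (List.ofFn x ∈ L → M.Accepts (List.ofFn x) a) ∧
      (List.ofFn x ∉ L → M.Rejects (List.ofFn x) a) ∧ M.UsesSpace (List.ofFn x) a s) :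
    ∃ A : Protocol (uniRing n), A.Computes (indicator L n) ∧
      Fintype.card A.Label = Nat.card {c : M.Config // M.Bounded n a.length s c} *
        ((Nat.card {c : M.Config // M.Bounded n a.length s c} + 1) * 2) := by
  have hs : 0 < s := (h fun _ => false).2.2 M.init Relation.ReflTransGen.refl
  let C := {c : M.Config // M.Bounded n a.length s c}
  have : Fintype C := Fintype.ofFinite C
  let start : C := ⟨M.init, Machine.bounded_init hs⟩
  have : Nonempty C := ⟨start⟩
  let acc : C → Bool := fun c => decide (c.1.state ∈ M.accept)
  refine ⟨queryProtocol (fun z : C × Fin (Nat.card C + 1) × Bool => Machine.inputPos n z.1.1)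
    (restart (Machine.boundedStep a) start acc (Nat.card C)) (fun z => z.2.2),
    queryProtocol_computes _ _ _ _ fun x z => ?_, ?_⟩
  · refine restart_eventually (Machine.boundedStep a) (fun c : C => x (Machine.inputPos n c.1))
      start acc _ _ ?_ z
    change acc ((Machine.inputStep x a)^[Nat.card C] start) = _
    obtain ⟨hacc, hrej, hspace⟩ := h x
    by_cases hx : List.ofFn x ∈ L
    · obtain ⟨c, hv, hh, hc⟩ := hacc hx
      have := Machine.iterate_card_of_halts x a hs hspace c hv hh
      simp only [acc, indicator, C, start, this, hx, hc]
    · obtain ⟨c, hv, hh, hc⟩ := hrej hx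
      have := Machine.iterate_card_of_halts x a hs hspace c hv hh
      simp only [acc, indicator, C, start, this, hx, hc]
  · change Fintype.card (C × Fin (Nat.card C + 1) × Bool) = _
    simp [C, Nat.card_eq_fintype_card]

theorem lPoly_subset_OSu : LPoly ⊆ OSu fun n : ℕ => Real.logb 2 n := by
  rintro L ⟨M, advice, s, p, hp, hs, hM⟩
  have hA : ∀ n, ∃ A : Protocol (uniRing n), (1 ≤ n → A.Computes (indicator L n)) ∧
      ∃ K, K ≤ Nat.card M.State * ((n + 2) * ((p.eval n + 2) * (s n * Nat.card M.Symbol ^ s n))) ∧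
        Fintype.card A.Label ≤ K * ((K + 1) * 2) + 1 := by
    intro n
    rcases Nat.eq_zero_or_pos n with rfl | hn
    -- nothing is required of the protocol on `0` nodes
    · exact ⟨{ Label := Unit, react := fun _ _ _ => (fun _ => (), false) },
        fun h => absurd h (by norm_num), 0, Nat.zero_le _, by simp⟩
    · have : NeZero n := ⟨hn.ne'⟩
      obtain ⟨A, hcomp, hcard⟩ := exists_protocol M (advice n) (s n) L fun x => by
        simpa using hM (List.ofFn x)
      refine ⟨A, fun _ => hcomp, _, Machine.card_bounded_le.trans ?_, hcard.le.trans
        (Nat.le_succ _)⟩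
      gcongr
      exact hp n
  choose A hcomp K hK hcard using hA
  refine ⟨A, hcomp, ?_⟩
  have hsp : PolyBounded s :=
    (PolyBounded.const_pow 2 hs).mono (Eventually.of_forall fun n => Nat.lt_two_pow_self.le)
  have hKb : PolyBounded K :=
    ((PolyBounded.const _).mul ((PolyBounded.id.add (PolyBounded.const 2)).mul
      (((PolyBounded.eval p).add (PolyBounded.const 2)).mul
        (hsp.mul (PolyBounded.const_pow (Nat.card M.Symbol) hs))))).mono (Eventually.of_forall hK)
  exact ((((hKb.mul ((hKb.add (PolyBounded.const 1)).mul (PolyBounded.const 2)))).add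
    (PolyBounded.const 1)).mono (Eventually.of_forall hcard)).isBigO_logb
      fun n => Fintype.card_pos

/-! ### A machine that executes its advice as a straight-line program -/

/-- The register of the interpreter. Within a block of records of a lookup table, `live` means that
the current record still matches, `dead` that it does not, and `done` that an earlier record of the
block has matched. -/
inductive Mode where
  | live
  | dead
  | done

instance : Finite Mode :=
  Finite.of_injective
    (fun m : Mode => (match m with | .live => 0 | .dead => 1 | .done => 2 : Fin 3))
    fun a b h => by cases a <;> cases b <;> simp_all

instance : Finite Move :=
  Finite.of_injective
    (fun m : Move => (match m with | .left => 0 | .stay => 1 | .right => 2 : Fin 3))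
    fun a b h => by cases a <;> cases b <;> simp_all

instance : Finite Cell :=
  Finite.of_injective (fun m : Cell => (match m with
    | .leftEnd => none | .rightEnd => some none | .bit b => some (some b) : Option (Option Bool)))
    fun a b h => by cases a <;> cases b <;> simp_all

/-- An instruction: from the register, the scanned input cell and the scanned bit of the work tape
it determines the new register, the bit to write, and the moves of the input head and of the work
head. As there are only finitely many functions of this kind, all of them are admitted. -/
abbrev Instr : Type := Mode → Cell → Bool → Mode × Bool × Move × Move

instance : Nonempty Instr := ⟨fun m _ b => (m, b, .stay, .stay)⟩

/-- The number of instructions. -/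
noncomputable def instrCount : ℕ := Nat.card Instr

instance : NeZero instrCount := ⟨Nat.card_pos.ne'⟩

/-- A numbering of the instructions. -/
noncomputable def instrEquiv : Instr ≃ Fin instrCount := Finite.equivFin Instr

/-- The interpreter. The advice is a sequence of instructions in unary code: the machine counts
the letters `true`, and at the next letter `false` it executes the instruction with that number.
It accepts if the register is `live` at the end of the advice. -/
noncomputable def interpreter : Machine where
  State := Mode × Fin instrCount
  Symbol := Bool
  start := (.live, 0)
  accept := {q | q.1 = .live}
  blank := false
  transition q ic ac b :=
    match ac with
    | .leftEnd => some ⟨q, b, .stay, .right, .stay⟩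
    | .bit true => some ⟨(q.1, q.2 + 1), b, .stay, .right, .stay⟩
    | .bit false =>
      let r := instrEquiv.symm q.2 q.1 ic b
      some ⟨(r.1, 0), r.2.1, r.2.2.1, .right, r.2.2.2⟩
    | .rightEnd => none

/-- The part of a configuration of the interpreter that the instructions act on. -/
structure Store where
  mode : Mode
  inputHead : ℕ
  workHead : ℕ
  work : ℕ → Bool

/-- The effect of an instruction on the input `x`. -/
def exec (x : List Bool) (i : Instr) (c : Store) : Store :=
  let r := i c.mode (readCell x c.inputHead) (c.work c.workHead)
  { mode := r.1
    inputHead := moveReadOnly x c.inputHead r.2.2.1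
    workHead := moveWork c.workHead r.2.2.2
    work := Function.update c.work c.workHead r.2.1 }

/-- The program leads from the first store to the second, and the work head stays in the first
`s` cells. -/
inductive Runs (x : List Bool) (s : ℕ) : List Instr → Store → Store → Prop
  | nil {c : Store} : c.workHead < s → Runs x s [] c c
  | cons {i : Instr} {p : List Instr} {c c' : Store} :
      c.workHead < s → Runs x s p (exec x i c) c' → Runs x s (i :: p) c c'

theorem Runs.append {x : List Bool} {s : ℕ} {p q : List Instr} {c c' c'' : Store}
    (h : Runs x s p c c') (h' : Runs x s q c' c'') : Runs x s (p ++ q) c c'' := by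
  induction h with
  | nil _ => exact h'
  | cons hc _ ih => exact .cons hc (ih h')

theorem Runs.single {x : List Bool} {s : ℕ} {i : Instr} {c c' : Store} (h : exec x i c = c')
    (hc : c.workHead < s) (hc' : c'.workHead < s) : Runs x s [i] c c' := by
  subst h
  exact .cons hc (.nil hc')

theorem Runs.cons_of_eq {x : List Bool} {s : ℕ} {i : Instr} {p : List Instr} {c c' c'' : Store}
    (h : exec x i c = c') (hc : c.workHead < s) (hp : Runs x s p c' c'') :
    Runs x s (i :: p) c c'' := by
  subst h
  exact .cons hc hp

/-- The unary code of a program. -/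
noncomputable def encode : List Instr → List Bool
  | [] => []
  | i :: p => List.replicate (instrEquiv i) true ++ false :: encode p

theorem length_encode_le (p : List Instr) : (encode p).length ≤ instrCount * p.length := by
  induction p with
  | nil => simp [encode]
  | cons i p ih =>
    have := (instrEquiv i).2
    simp only [encode, List.length_append, List.length_replicate, List.length_cons]
    rw [Nat.mul_succ]
    omega

/-- The computation from the configuration `c` halts in a state that satisfies `S`, and the work
head stays in the first `s` cells. -/
def Machine.Ends (M : Machine) (x a : List Bool) (s : ℕ) (S : M.State → Prop) (c : M.Config) :
    Prop :=
  (∃ d, StateTransition.Reaches (M.step x a) c d ∧ M.step x a d = none ∧ S d.state) ∧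
    ∀ d, StateTransition.Reaches (M.step x a) c d → d.workHead < s

theorem Machine.Ends.of_halt {M : Machine} {x a : List Bool} {s : ℕ} {S : M.State → Prop}
    {c : M.Config} (h : M.step x a c = none) (hS : S c.state) (hw : c.workHead < s) :
    M.Ends x a s S c := by
  refine ⟨⟨c, .refl, h, hS⟩, fun d hd => ?_⟩
  rcases Relation.ReflTransGen.cases_head hd with rfl | ⟨e, he, -⟩
  · exact hw
  · rw [h] at he
    cases he

theorem Machine.Ends.of_step {M : Machine} {x a : List Bool} {s : ℕ} {S : M.State → Prop}
    {c c' : M.Config} (h : M.step x a c = some c') (hw : c.workHead < s)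
    (hc' : M.Ends x a s S c') : M.Ends x a s S c := by
  obtain ⟨⟨d, hd, hh, hS⟩, hsp⟩ := hc'
  refine ⟨⟨d, .head h hd, hh, hS⟩, fun d hd => ?_⟩
  rcases Relation.ReflTransGen.cases_head hd with rfl | ⟨e, he, hed⟩
  · exact hw
  · rw [h] at he
    cases he
    exact hsp d hed

theorem Machine.Ends.imp {M : Machine} {x a : List Bool} {s : ℕ} {S S' : M.State → Prop}
    {c : M.Config} (h : M.Ends x a s S c) (hS : ∀ q, S q → S' q) : M.Ends x a s S' c := by
  obtain ⟨⟨d, hd, hh, hq⟩, hsp⟩ := h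
  exact ⟨⟨d, hd, hh, hS _ hq⟩, hsp⟩

/-- The configuration of the interpreter with the given store, instruction counter and position
of the advice head. -/
def Store.config (c : Store) (k : Fin instrCount) (i : ℕ) : interpreter.Config :=
  ⟨(c.mode, k), c.inputHead, i, c.workHead, c.work⟩

theorem readCell_append (u : List Bool) (b : Bool) (v : List Bool) :
    readCell (u ++ b :: v) (u.length + 1) = .bit b := by
  simp [readCell]

theorem readCell_length (u : List Bool) : readCell u (u.length + 1) = .rightEnd := by
  simp [readCell]

theorem moveReadOnly_append (u : List Bool) (b : Bool) (v : List Bool) :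
    moveReadOnly (u ++ b :: v) (u.length + 1) .right = (u ++ [b]).length + 1 := by
  simp [moveReadOnly]

theorem step_true (x u v : List Bool) (c : Store) (k : Fin instrCount) :
    interpreter.step x (u ++ true :: v) (c.config k (u.length + 1)) =
      some (c.config (k + 1) ((u ++ [true]).length + 1)) := by
  simp only [Machine.step, Store.config, interpreter, readCell_append, Option.map_some,
    moveReadOnly_append, Function.update_eq_self]
  rfl

theorem step_false (x u v : List Bool) (c : Store) (k : Fin instrCount) :
    interpreter.step x (u ++ false :: v) (c.config k (u.length + 1)) =
      some ((exec x (instrEquiv.symm k) c).config 0 ((u ++ [false]).length + 1)) := by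
  simp only [Machine.step, Store.config, interpreter, readCell_append, Option.map_some,
    moveReadOnly_append]
  rfl

/-- Reading a unary number adds it to the instruction counter. -/
theorem ends_replicate (x : List Bool) (s : ℕ) (S : interpreter.State → Prop) (c : Store)
    (hc : c.workHead < s) (v : List Bool) (r : ℕ) (u : List Bool) (k : Fin instrCount)
    (h : interpreter.Ends x ((u ++ List.replicate r true) ++ v) s S
      (c.config (k + Fin.ofNat instrCount r) ((u ++ List.replicate r true).length + 1))) :
    interpreter.Ends x ((u ++ List.replicate r true) ++ v) s S (c.config k (u.length + 1)) := by
  induction r generalizing u k with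
  | zero => simpa using h
  | succ r ih =>
    have hu : u ++ List.replicate (r + 1) true = (u ++ [true]) ++ List.replicate r true := by
      simp [List.replicate_succ]
    have hk : k + Fin.ofNat instrCount (r + 1) = (k + 1) + Fin.ofNat instrCount r := by
      rw [add_assoc]
      congr 1
      ext
      simp [Fin.val_add, add_comm]
    rw [hu, hk] at h
    rw [hu]
    refine Machine.Ends.of_step ?_ hc (ih (u ++ [true]) (k + 1) h)
    rw [List.append_assoc, List.append_assoc]
    exact step_true x u _ c k

theorem ends_encode {x : List Bool} {s : ℕ} {p : List Instr} {c c' : Store} (h : Runs x s p c c')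
    (u : List Bool) :
    interpreter.Ends x (u ++ encode p) s (fun q => q.1 = c'.mode) (c.config 0 (u.length + 1)) := by
  induction h generalizing u with
  | nil hc =>
    refine .of_halt ?_ rfl hc
    simp only [encode, List.append_nil, Machine.step, Store.config, interpreter, readCell_length,
      Option.map_none]
  | @cons i p c c' hc _ ih =>
    rw [encode, ← List.append_assoc]
    refine ends_replicate x s _ c hc _ _ u 0 (.of_step (step_false x _ _ c _) hc ?_)
    have := ih ((u ++ List.replicate (instrEquiv i) true) ++ [false])
    simpa using this

/-- The interpreter computes what the program computes. -/
theorem interpreter_ends {x : List Bool} {s : ℕ} {p : List Instr} {c : Store}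
    (h : Runs x s p ⟨.live, 0, 0, fun _ => false⟩ c) :
    interpreter.Ends x (encode p) s (fun q => q.1 = c.mode) interpreter.init := by
  have hs : 0 < s := by cases h <;> assumption
  refine .of_step (c' := Store.config ⟨.live, 0, 0, fun _ => false⟩ 0 1) ?_ hs
    (ends_encode h [])
  simp only [Machine.step, Machine.init, interpreter, readCell, Option.map_some,
    Function.update_eq_self, moveReadOnly, moveWork, Store.config]
  congr 2

/-! ### Lookup tables as programs -/

/-- Move the input head to the right. -/
def inputRight : Instr := fun m _ b => (m, b, .right, .stay)

/-- Move the input head to the left. -/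
def inputLeft : Instr := fun m _ b => (m, b, .left, .stay)

/-- Move the work head to the left. -/
def workLeft : Instr := fun m _ b => (m, b, .stay, .left)

open Classical in
/-- Test whether the scanned input bit is `v`. -/
noncomputable def testInput (v : Bool) : Instr := fun m i b =>
  (match m with
    | .live => if i = .bit v then .live else .dead
    | m => m, b, .stay, .stay)

/-- Test whether the scanned bit of the work tape is `v`, and move the work head to the right. -/
def testWork (v : Bool) : Instr := fun m _ b =>
  (match m with
    | .live => if b = v then .live else .dead
    | m => m, b, .stay, .right)

/-- Write `v` if the current record matches, and move the work head to the left. -/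
def writeWork (v : Bool) : Instr := fun m _ b =>
  (m, match m with
    | .live => v
    | _ => b, .stay, .left)

/-- The end of a record. -/
def endRecord : Instr := fun m _ b =>
  (match m with
    | .dead => .live
    | _ => .done, b, .stay, .stay)

/-- The end of a block of records. -/
def endBlock : Instr := fun _ _ b => (.live, b, .stay, .stay)

/-- Test whether the word in the first `w` cells of the work tape is the binary code of `u`. -/
def testWord (u : ℕ) (w : ℕ) : List Instr :=
  (List.range w).map fun j => testWork (u.testBit j)

/-- Write the binary code of `y` into the first `w` cells of the work tape, from right to left, if
the current record matches. -/
def writeWord (y : ℕ) : ℕ → List Instr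
  | 0 => []
  | j + 1 => writeWork (y.testBit j) :: writeWord y j

/-- The record of a lookup table: if the work tape contains `u` and the input bit is `b`, then
replace `u` with `y`. -/
noncomputable def record (w u : ℕ) (b : Bool) (y : ℕ) : List Instr :=
  testInput b :: (testWord u w ++ workLeft :: (writeWord y w ++ [endRecord]))

variable {x : List Bool} {s : ℕ}

open Classical in
theorem runs_testWord (u : ℕ) (i : ℕ) (τ : ℕ → Bool) (w : ℕ) (hw : w < s) :
    Runs x s (testWord u w) ⟨.live, i, 0, τ⟩
      ⟨if ∀ j < w, τ j = u.testBit j then .live else .dead, i, w, τ⟩ := by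
  induction w with
  | zero => simpa [testWord] using Runs.nil (c := ⟨.live, i, 0, τ⟩) hw
  | succ w ih =>
    rw [testWord, List.range_succ, List.map_append]
    refine (ih (by omega)).append (.single ?_ (Nat.lt_of_succ_lt hw) hw)
    simp only [exec, testWork, moveReadOnly, moveWork, Function.update_eq_self]
    congr 1
    simp only [Nat.lt_succ_iff_lt_or_eq, or_imp, forall_and, forall_eq]
    by_cases h : ∀ j < w, τ j = u.testBit j
    · rw [if_pos h]
      simp only [and_iff_right h]
    · rw [if_neg h]
      simp [h]

/-- Unless the register is `live`, a test leaves it alone; the work head moves all the same. -/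
theorem runs_testWord_of_ne (u : ℕ) (i : ℕ) (τ : ℕ → Bool) (w : ℕ) (hw : w < s) (m : Mode)
    (hm : m ≠ .live) : Runs x s (testWord u w) ⟨m, i, 0, τ⟩ ⟨m, i, w, τ⟩ := by
  induction w with
  | zero => exact Runs.nil (c := ⟨m, i, 0, τ⟩) hw
  | succ w ih =>
    rw [testWord, List.range_succ, List.map_append]
    refine (ih (by omega)).append (.single ?_ (Nat.lt_of_succ_lt hw) hw)
    simp only [exec, testWork, moveReadOnly, moveWork, Function.update_eq_self]

/-- As `writeWord y w` starts in the cell `w - 1`, its last move to the left, in the cell `0`, has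
no effect. For `w = 0` there is nothing to write, and the truncated `w - 1` is the cell `0` as well. -/
theorem runs_writeWord (y : ℕ) (i : ℕ) (τ : ℕ → Bool) (w : ℕ) (hw : w - 1 < s) :
    Runs x s (writeWord y w) ⟨.live, i, w - 1, τ⟩
      ⟨.live, i, 0, fun j => if j < w then y.testBit j else τ j⟩ := by
  induction w generalizing τ with
  | zero => simpa [writeWord] using Runs.nil (c := ⟨.live, i, 0, τ⟩) hw
  | succ w ih =>
    have hτ : (fun j => if j < w + 1 then y.testBit j else τ j) =
        fun j => if j < w then y.testBit j else Function.update τ w (y.testBit w) j := by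
      funext j
      rcases lt_trichotomy j w with h | rfl | h
      · simp [h, h.trans (Nat.lt_succ_self w)]
      · simp
      · have h₁ : ¬ j < w := by omega
        have h₂ : ¬ j < w + 1 := by omega
        simp [h₁, h₂, h.ne']
    rw [hτ]
    exact .cons hw (ih _ (by omega))

theorem runs_writeWord_of_ne (y : ℕ) (i : ℕ) (τ : ℕ → Bool) (w : ℕ) (hw : w - 1 < s) (m : Mode)
    (hm : m ≠ .live) : Runs x s (writeWord y w) ⟨m, i, w - 1, τ⟩ ⟨m, i, 0, τ⟩ := by
  induction w with
  | zero => exact Runs.nil (c := ⟨m, i, 0, τ⟩) hw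
  | succ w ih =>
    refine .cons_of_eq ?_ hw (ih (by omega))
    cases m <;> simp_all [exec, writeWork, moveReadOnly, moveWork]

/-- The register after a record that has not matched. -/
def Mode.afterRecord : Mode → Mode
  | .dead => .live
  | _ => .done

theorem runs_endRecord (m : Mode) (i : ℕ) (τ : ℕ → Bool) (hs : 0 < s) :
    Runs x s [endRecord] ⟨m, i, 0, τ⟩ ⟨m.afterRecord, i, 0, τ⟩ :=
  .single (by cases m <;> simp [exec, endRecord, moveReadOnly, moveWork, Mode.afterRecord]) hs hs

theorem exec_workLeft (m : Mode) (i w : ℕ) (τ : ℕ → Bool) :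
    exec x workLeft ⟨m, i, w, τ⟩ = ⟨m, i, w - 1, τ⟩ := by
  simp [exec, workLeft, moveReadOnly, moveWork]

theorem runs_record_tail_of_ne (w y i : ℕ) (τ : ℕ → Bool) (hw : w < s) (m : Mode)
    (hm : m ≠ .live) :
    Runs x s (workLeft :: (writeWord y w ++ [endRecord])) ⟨m, i, w, τ⟩
      ⟨m.afterRecord, i, 0, τ⟩ :=
  .cons_of_eq (exec_workLeft m i w τ) hw ((runs_writeWord_of_ne y i τ w (by omega) m hm).append
    (runs_endRecord m i τ (by omega)))

theorem runs_record_done (w u : ℕ) (b : Bool) (y i : ℕ) (τ : ℕ → Bool) (hw : w < s) :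
    Runs x s (record w u b y) ⟨.done, i, 0, τ⟩ ⟨.done, i, 0, τ⟩ :=
  .cons_of_eq (c' := ⟨.done, i, 0, τ⟩) (by simp [exec, testInput, moveReadOnly, moveWork])
    (Nat.zero_lt_of_lt hw) ((runs_testWord_of_ne u i τ w hw .done (by simp)).append
      (runs_record_tail_of_ne w y i τ hw .done (by simp)))

theorem forall_testBit_eq_iff {k u w : ℕ} (hk : k < 2 ^ w) (hu : u < 2 ^ w) :
    (∀ j < w, k.testBit j = u.testBit j) ↔ k = u := by
  refine ⟨fun h => Nat.eq_of_testBit_eq fun j => ?_, fun h => by simp [h]⟩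
  rcases lt_or_ge j w with hj | hj
  · exact h j hj
  · have hp : 2 ^ w ≤ 2 ^ j := Nat.pow_le_pow_right two_pos hj
    rw [Nat.testBit_lt_two_pow (hk.trans_le hp), Nat.testBit_lt_two_pow (hu.trans_le hp)]

open Classical in
/-- A record acts if the work tape contains its key and the input bit is the right one. -/
theorem runs_record_live (w k u : ℕ) (b v : Bool) (y i : ℕ) (hw : w < s) (hk : k < 2 ^ w)
    (hu : u < 2 ^ w) (hy : y < 2 ^ w) (hi : readCell x i = .bit v) :
    Runs x s (record w u b y) ⟨.live, i, 0, k.testBit⟩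
      (if k = u ∧ v = b then ⟨.done, i, 0, y.testBit⟩ else ⟨.live, i, 0, k.testBit⟩) := by
  have hs : 0 < s := by omega
  by_cases hv : v = b
  · refine .cons_of_eq (c' := ⟨.live, i, 0, k.testBit⟩)
      (by simp [exec, testInput, moveReadOnly, moveWork, hi, hv]) hs
      ((runs_testWord u i k.testBit w hw).append ?_)
    simp only [forall_testBit_eq_iff hk hu]
    by_cases hku : k = u
    · simp only [hku, hv, and_self, if_true]
      have hτ : (fun j => if j < w then y.testBit j else u.testBit j) = y.testBit := by
        funext j
        rcases lt_or_ge j w with hj | hj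
        · simp [hj]
        · have hp : 2 ^ w ≤ 2 ^ j := Nat.pow_le_pow_right two_pos hj
          rw [if_neg hj.not_gt, Nat.testBit_lt_two_pow (hu.trans_le hp),
            Nat.testBit_lt_two_pow (hy.trans_le hp)]
      have hwrite := runs_writeWord (x := x) y i u.testBit w (by omega : w - 1 < s)
      rw [hτ] at hwrite
      exact .cons_of_eq (exec_workLeft _ i w _) hw (hwrite.append (runs_endRecord .live i _ hs))
    · simp only [hku, false_and, if_false]
      exact runs_record_tail_of_ne w y i _ hw .dead (by simp)
  · simp only [hv, and_false, if_false]
    exact .cons_of_eq (c' := ⟨.dead, i, 0, k.testBit⟩)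
      (by simp [exec, testInput, moveReadOnly, moveWork, hi, hv]) hs
      ((runs_testWord_of_ne u i _ w hw .dead (by simp)).append
        (runs_record_tail_of_ne w y i _ hw .dead (by simp)))

/-- The records of the lookup table `g`, for the listed keys; labels are coded by `code`. -/
noncomputable def table {V : Type} (code : V → ℕ) (w : ℕ) (g : V → Bool → ℕ)
    (l : List (V × Bool)) : List Instr :=
  l.flatMap fun r => record w (code r.1) r.2 (g r.1 r.2)

/-- After a match the rest of the table is without effect, even if the new label is a key in it. -/
theorem runs_table_done {V : Type} (code : V → ℕ) (w : ℕ) (g : V → Bool → ℕ)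
    (l : List (V × Bool)) (i : ℕ) (τ : ℕ → Bool) (hw : w < s) :
    Runs x s (table code w g l) ⟨.done, i, 0, τ⟩ ⟨.done, i, 0, τ⟩ := by
  induction l with
  | nil => exact .nil (Nat.zero_lt_of_lt hw)
  | cons r l ih => exact (runs_record_done _ _ _ _ _ _ hw).append ih

theorem runs_table {V : Type} (code : V → ℕ) (hcode : Function.Injective code) (w : ℕ)
    (hlt : ∀ v, code v < 2 ^ w) (g : V → Bool → ℕ) (hg : ∀ v b, g v b < 2 ^ w)
    (l : List (V × Bool)) (v : V) (b : Bool) (hl : (v, b) ∈ l) (i : ℕ) (hw : w < s)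
    (hi : readCell x i = .bit b) :
    Runs x s (table code w g l) ⟨.live, i, 0, (code v).testBit⟩
      ⟨.done, i, 0, (g v b).testBit⟩ := by
  classical
  induction l with
  | nil => cases hl
  | cons r l ih =>
    have hr := runs_record_live (x := x) w (code v) (code r.1) r.2 b (g r.1 r.2) i hw (hlt _)
      (hlt _) (hg _ _) hi
    by_cases h : (v, b) = r
    · subst h
      simp only [and_self, if_true] at hr
      exact hr.append (runs_table_done code w g l i _ hw)
    · have hne : ¬ (code v = code r.1 ∧ b = r.2) := fun ⟨h₁, h₂⟩ => h (Prod.ext (hcode h₁) h₂)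
      rw [if_neg hne] at hr
      exact hr.append (ih ((List.mem_cons.mp hl).resolve_left h))

/-- The program that moves the input head to the cell `i`, replaces the label on the work tape
according to the lookup table `g`, and moves the input head back. -/
noncomputable def lookup {V : Type} [Fintype V] (code : V → ℕ) (w i : ℕ) (g : V → Bool → ℕ) :
    List Instr :=
  List.replicate i inputRight ++ (table code w g Finset.univ.toList ++
    endBlock :: List.replicate i inputLeft)

theorem runs_inputRight (i : ℕ) (hi : i ≤ x.length + 1) (τ : ℕ → Bool) (hs : 0 < s) :
    Runs x s (List.replicate i inputRight) ⟨.live, 0, 0, τ⟩ ⟨.live, i, 0, τ⟩ := by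
  induction i with
  | zero => exact .nil hs
  | succ i ih =>
    rw [List.replicate_succ']
    refine (ih (by omega)).append (.single ?_ hs hs)
    simp [exec, inputRight, moveReadOnly, moveWork]
    omega

theorem runs_inputLeft (i : ℕ) (τ : ℕ → Bool) (hs : 0 < s) :
    Runs x s (List.replicate i inputLeft) ⟨.live, i, 0, τ⟩ ⟨.live, 0, 0, τ⟩ := by
  induction i with
  | zero => exact .nil hs
  | succ i ih =>
    exact .cons_of_eq (by simp [exec, inputLeft, moveReadOnly, moveWork]) hs ih

theorem runs_lookup {V : Type} [Fintype V] (code : V → ℕ) (hcode : Function.Injective code)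
    (w : ℕ) (hlt : ∀ v, code v < 2 ^ w) (g : V → Bool → ℕ) (hg : ∀ v b, g v b < 2 ^ w) (v : V)
    (b : Bool) (i : ℕ) (hw : w < s) (hx : x[i]? = some b) :
    Runs x s (lookup code w (i + 1) g) ⟨.live, 0, 0, (code v).testBit⟩
      ⟨.live, 0, 0, (g v b).testBit⟩ := by
  have hs : 0 < s := Nat.zero_lt_of_lt hw
  obtain ⟨hlen, -⟩ := List.getElem?_eq_some_iff.mp hx
  refine (runs_inputRight (i + 1) (by omega) _ hs).append
    ((runs_table code hcode w hlt g hg _ v b (by simp) (i + 1) hw (by simp [readCell, hx])).append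
      (.cons_of_eq ?_ hs (runs_inputLeft (i + 1) _ hs)))
  simp [exec, endBlock, moveReadOnly, moveWork]

theorem length_writeWord (y w : ℕ) : (writeWord y w).length = w := by
  induction w with
  | zero => rfl
  | succ w ih => simp [writeWord, ih]

theorem length_lookup {V : Type} [Fintype V] (code : V → ℕ) (w i : ℕ) (g : V → Bool → ℕ) :
    (lookup code w i g).length =
      2 * i + 1 + Fintype.card V * 2 * (2 * w + 3) := by
  have : ∀ l : List (V × Bool), (table code w g l).length = l.length * (2 * w + 3) := by
    intro l
    induction l with
    | nil => simp [table]
    | cons r l ih =>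
      have h : table code w g (r :: l) =
        record w (code r.1) r.2 (g r.1 r.2) ++ table code w g l := rfl
      rw [h, List.length_append, ih]
      simp only [record, testWord, List.length_cons, List.length_append, List.length_map,
        List.length_range, length_writeWord, List.length_nil]
      ring
  simp only [lookup, List.length_append, List.length_replicate, this, List.length_cons,
    Finset.length_toList, Finset.card_univ, Fintype.card_prod, Fintype.card_bool]
  ring

/-! ### From protocols to a machine -/

variable {n : ℕ} [NeZero n]

/-- The program that follows a label of the protocol `A` on the ring for `t` steps after it has left
the node `i`, and then evaluates the output of the next node. The input bit of the node `i + 1` is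
in the cell `(i + 1) + 1` of the input tape, whose cell `0` holds the end marker; the first sum is
modulo `n`, the second one is not. The output is written on the work tape as the label `0` or `1`. -/
noncomputable def ringProgram (A : Protocol (uniRing n)) (code : A.Label → ℕ) (w : ℕ) :
    ℕ → Fin n → List Instr
  | 0, i =>
    lookup code w ((i + 1 : Fin n) + 1) (fun v b => (A.emit (i + 1) v b).toNat) ++ [testWork true]
  | t + 1, i =>
    lookup code w ((i + 1 : Fin n) + 1) (fun v b => code (A.pass (i + 1) v b)) ++
      ringProgram A code w t (i + 1)

theorem runs_ringProgram (A : Protocol (uniRing n)) (code : A.Label → ℕ)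
    (hcode : Function.Injective code) (w : ℕ) (hw : 0 < w) (hlt : ∀ v, code v < 2 ^ w)
    (x : Fin n → Bool) (t : ℕ) (p : A.Label × Fin n) :
    ∃ c, Runs (List.ofFn x) (w + 1) (ringProgram A code w t p.2)
        ⟨.live, 0, 0, (code p.1).testBit⟩ c ∧
      (c.mode = .live ↔ A.emit (((A.token x)^[t] p).2 + 1) ((A.token x)^[t] p).1
        (x (((A.token x)^[t] p).2 + 1)) = true) := by
  induction t generalizing p with
  | zero =>
    refine ⟨_, (runs_lookup code hcode w hlt _ (fun v b => ?_) p.1 (x (p.2 + 1)) _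
      (Nat.lt_succ_self w) (by simp)).append (.single rfl (Nat.succ_pos w) ?_), ?_⟩
    · exact (Bool.toNat_lt _).trans_le (Nat.pow_le_pow_right two_pos hw)
    · simpa [exec, testWork, moveWork] using hw
    · cases h : A.emit (p.2 + 1) p.1 (x (p.2 + 1)) <;> simp [exec, testWork, h]
  | succ t ih =>
    obtain ⟨c, hc, hm⟩ := ih (A.token x p)
    refine ⟨c, (runs_lookup code hcode w hlt _ (fun v b => hlt _) p.1 (x (p.2 + 1)) _
      (Nat.lt_succ_self w) (by simp)).append hc, ?_⟩
    rw [hm, Function.iterate_succ_apply]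

theorem length_ringProgram_le (A : Protocol (uniRing n)) (code : A.Label → ℕ) (w t : ℕ)
    (i : Fin n) : (ringProgram A code w t i).length ≤
      (t + 1) * (2 * n + 1 + Fintype.card A.Label * 2 * (2 * w + 3)) + 1 := by
  induction t generalizing i with
  | zero =>
    have := (i + 1).2
    simp only [ringProgram, List.length_append, length_lookup, List.length_singleton]
    omega
  | succ t ih =>
    have := (i + 1).2
    have := ih (i + 1)
    simp only [ringProgram, List.length_append, length_lookup]
    rw [add_mul (t + 1) 1, one_mul]
    omega

/-- A protocol on the `n`-ring with `N` labels yields an advice string with which the interpreter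
decides the same words of length `n`: after as many steps as there are pairs of a label and a node,
the label has entered its cycle, where it yields the correct output. -/
theorem exists_program (A : Protocol (uniRing n)) (f : (Fin n → Bool) → Bool)
    (hA : A.Computes f) : ∃ p : List Instr,
      p.length ≤ (Fintype.card A.Label * n + 1) *
        (2 * n + 1 + Fintype.card A.Label * 2 * (2 * (Nat.log 2 (Fintype.card A.Label) + 1) + 3))
          + 1 ∧
      ∀ x : Fin n → Bool, interpreter.Ends (List.ofFn x) (encode p)
        (Nat.log 2 (Fintype.card A.Label) + 2) (fun q => q.1 = .live ↔ f x = true)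
        interpreter.init := by
  set N := Fintype.card A.Label with hN
  have hNpos : 0 < N := Fintype.card_pos
  let e : A.Label ≃ Fin N := Fintype.equivFin A.Label
  let v₀ : A.Label := e.symm ⟨0, hNpos⟩
  let code : A.Label → ℕ := fun v => e v
  have hcode : Function.Injective code := fun u v h => e.injective (Fin.ext h)
  have hlt : ∀ v, code v < 2 ^ (Nat.log 2 N + 1) := fun v =>
    (e v).2.trans (Nat.lt_pow_succ_log_self one_lt_two N)
  refine ⟨ringProgram A code (Nat.log 2 N + 1) (N * n) 0, length_ringProgram_le A code _ _ _,
    fun x => ?_⟩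
  have hout := iterate_card_of_eventually (A.token x) (v₀, 0)
    (fun p => A.emit (p.2 + 1) p.1 (x (p.2 + 1)) = f x)
    ((A.computes_iff_token f).mp hA x (v₀, 0))
  rw [Fintype.card_prod, Fintype.card_fin, ← hN] at hout
  obtain ⟨c, hc, hm⟩ := runs_ringProgram A code hcode _ (Nat.succ_pos _) hlt x (N * n) (v₀, 0)
  rw [hout] at hm
  -- the label with code `0` is on the blank work tape from the outset
  have h0 : (code v₀).testBit = fun _ => false := by
    funext j
    simp [code, v₀]
  rw [h0] at hc
  exact (interpreter_ends hc).imp fun q hq => by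
    have hq : q.1 = c.mode := hq
    change q.1 = Mode.live ↔ _
    rw [hq, hm]

theorem OSu_subset_lPoly : OSu (fun n : ℕ => Real.logb 2 n) ⊆ LPoly := by
  classical
  rintro L ⟨A, hA, hcard⟩
  set N : ℕ → ℕ := fun n => Fintype.card (A n).Label with hN
  have hNpos : ∀ n, 0 < N n := fun n => Fintype.card_pos
  have hNb : PolyBounded N := PolyBounded.of_isBigO_logb hcard
  let len : ℕ → ℕ := fun n =>
    (N n * n + 1) * (2 * n + 1 + N n * 2 * (2 * (Nat.log 2 (N n) + 1) + 3)) + 1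
  have hprog : ∀ n, ∃ p : List Instr, p.length ≤ len n ∧ ∀ x : Fin n → Bool,
      interpreter.Ends (List.ofFn x) (encode p) (Nat.log 2 (N n) + 2)
        (fun q => q.1 = .live ↔ indicator L n x = true) interpreter.init := by
    intro n
    rcases Nat.eq_zero_or_pos n with rfl | hn
    -- there is no ring with `0` nodes: the program for the empty word is the answer itself
    · by_cases h : [] ∈ L
      · refine ⟨[], Nat.zero_le _, fun x => ?_⟩
        have := interpreter_ends (Runs.nil (x := List.ofFn x) (s := Nat.log 2 (N 0) + 2)
          (c := ⟨.live, 0, 0, fun _ => false⟩) (by simp))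
        obtain ⟨⟨d, hd, hh, hS⟩, hsp⟩ := this
        exact ⟨⟨d, hd, hh, by simp [hS, indicator, h]⟩, hsp⟩
      · refine ⟨[testWork true], by simp [len], fun x => ?_⟩
        have := interpreter_ends (Runs.single (x := List.ofFn x) (s := Nat.log 2 (N 0) + 2)
          (i := testWork true) (c := ⟨.live, 0, 0, fun _ => false⟩) rfl (by simp)
            (by simp [exec, testWork, moveWork]))
        obtain ⟨⟨d, hd, hh, hS⟩, hsp⟩ := this
        exact ⟨⟨d, hd, hh, by simp [hS, indicator, h, exec, testWork]⟩, hsp⟩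
    · have : NeZero n := ⟨hn.ne'⟩
      exact exists_program (A n) _ (hA n hn)
  choose prog hlen hends using hprog
  have hlogb : PolyBounded fun n => Nat.log 2 (N n) :=
    hNb.mono (Eventually.of_forall fun n => Nat.log_le_self 2 (N n))
  have hlenb : PolyBounded len :=
    ((((hNb.mul .id).add (.const 1)).mul ((((PolyBounded.const 2).mul .id).add (.const 1)).add
      ((hNb.mul (.const 2)).mul (((PolyBounded.const 2).mul (hlogb.add (.const 1))).add
        (.const 3)))))).add (.const 1)
  obtain ⟨p, hp⟩ := ((PolyBounded.const instrCount).mul hlenb).exists_polynomial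
  refine ⟨interpreter, fun n => encode (prog n), fun n => Nat.log 2 (N n) + 2, p, fun n => ?_, ?_,
    fun x => ?_⟩
  · exact (length_encode_le _).trans ((Nat.mul_le_mul_left _ (hlen n)).trans (hp n))
  · refine IsBigO.trans (g := fun n => Real.logb 2 (N n) + 2) (.of_bound 1 ?_)
      (hcard.add (by simpa using one_isBigO_logb.const_mul_left 2))
    refine Eventually.of_forall fun n => ?_
    have h1 : (1 : ℝ) ≤ N n := by exact_mod_cast hNpos n
    have h2 : (Nat.log 2 (N n) : ℝ) ≤ Real.logb 2 (N n) := by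
      simpa using Real.natLog_le_logb (N n) 2
    have h3 := Real.logb_nonneg one_lt_two h1
    rw [one_mul, Real.norm_of_nonneg (by positivity), Real.norm_of_nonneg (by positivity)]
    push_cast
    linarith
  · obtain ⟨⟨d, hd, hh, hS⟩, hsp⟩ := hends x.length x.get
    rw [List.ofFn_get] at hd hh hsp
    have hind : indicator L x.length x.get = true ↔ x ∈ L := by simp [indicator]
    rw [hind] at hS
    exact ⟨fun hx => ⟨d, hd, hh, hS.mpr hx⟩, fun hx => ⟨d, hd, hh, fun h => hx (hS.mp h)⟩, hsp⟩

end AdviceTM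

theorem theorem4 : Stateless.OSu (fun n : ℕ => Real.logb 2 n) = AdviceTM.LPoly :=
  Set.Subset.antisymm AdviceTM.OSu_subset_lPoly AdviceTM.lPoly_subset_OSu
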